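/- Let $n\ge 3$. Let $U(\mathbb{R})\subseteq \mathrm{GL}_n(\mathbb{R})$ be the group of upper triangular unipotent matrices, let $U^{\top}(\mathbb{R})$ be its transpose, and identify the Weyl group $W$ of $\mathrm{GL}_n$ with the group of $n\times n$ permutation matrices. For $w\in W$ set $$U_w(\mathbb{R}) = w^{-1}U^{\top}(\mathbb{R})w\cap U(\mathbb{R}),$$ equipped with the measure $dx=\prod dx_{ij}$, where the product runs over the pairs $i<j$ for which the matrix entry $x_{ij}$ does not vanish identically on $U_w(\mathbb{R})$. (If there are no such pairs, then $U_w(\mathbb{R})$ is a single point, of volume $1$.) For $g\in \mathrm{GL}_n(\mathbb{R})$ and $1\le j\le n$ let $\Delta_j(g)$ be the $j$-dimensional volume of the parallelepiped in Euclidean space $\mathbb{R}^n$ spanned by the last $j$ rows of $g$. Then for every $\epsilon>0$ there is a constant $C>0$, depending only on $n$ and $\epsilon$, such that for every $w\in W$ and every $B=(B_1,\ldots,B_{n-1})\in\mathbb{R}_{>0}^{n-1}$, $$\mathrm{vol}\{x\in U_w(\mathbb{R}) : \Delta_j(wx)\le B_j \text{ for } 1\le j\le n-1\}\le C\,(B_1\cdots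 B_{n-1})^{1+\epsilon}.$$ -/

import Mathlib

open MeasureTheory Matrix

noncomputable section

namespace WeylVolume

/-- The group `U(ℝ)` of upper triangular unipotent matrices, as a subset of `GL_n(ℝ)`. -/
def unipotent (n : ℕ) : Set (GL (Fin n) ℝ) :=
  {x | (∀ i, x.val i i = 1) ∧ ∀ i j, j < i → x.val i j = 0}

/-- The transposed group `U^⊤(ℝ)`: lower triangular unipotent matrices. -/
def unipotentTranspose (n : ℕ) : Set (GL (Fin n) ℝ) :=
  {v | ∃ u ∈ unipotent n, v.val = (u.val)ᵀ}

/-- The Weyl element of the permutation `σ`: the permutation matrix sending the standard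
basis vector `e_j` to `e_{σ j}`. -/
def weyl {n : ℕ} (σ : Equiv.Perm (Fin n)) : GL (Fin n) ℝ where
  val := (σ⁻¹).permMatrix ℝ
  inv := σ.permMatrix ℝ
  val_inv := by rw [← Matrix.permMatrix_mul]; simp
  inv_val := by rw [← Matrix.permMatrix_mul]; simp

theorem weyl_apply {n : ℕ} (σ : Equiv.Perm (Fin n)) (i j : Fin n) :
    (weyl σ).val i j = if i = σ j then 1 else 0 := by
  have h : σ⁻¹ i = j ↔ i = σ j := Equiv.Perm.inv_eq_iff_eq
  simp only [weyl, Equiv.Perm.permMatrix, PEquiv.toMatrix_apply, Equiv.toPEquiv_apply,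
    Option.mem_def, Option.some.injEq, h]

/-- `U_w(ℝ) = w⁻¹ U^⊤(ℝ) w ∩ U(ℝ)`, for `w` the Weyl element of `σ`. -/
def weylU {n : ℕ} (σ : Equiv.Perm (Fin n)) : Set (GL (Fin n) ℝ) :=
  {x | ∃ v ∈ unipotentTranspose n, x = (weyl σ)⁻¹ * v * weyl σ} ∩ unipotent n

/-- The inversions of `σ`: the pairs `(i, j)` whose root `e_i - e_j` is positive and is made
negative by the Weyl element of `σ`. These are the matrix positions of the coordinates
of `U_w(ℝ)`. -/
abbrev Inversion {n : ℕ} (σ : Equiv.Perm (Fin n)) : Type :=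
  {p : Fin n × Fin n // p.1 < p.2 ∧ σ p.2 < σ p.1}

theorem conj_val {n : ℕ} (σ : Equiv.Perm (Fin n)) (v : GL (Fin n) ℝ) (i j : Fin n) :
    ((weyl σ)⁻¹ * v * weyl σ).val i j = v.val (σ i) (σ j) := by
  have h1 : ((weyl σ)⁻¹ : GL (Fin n) ℝ).val = σ.toPEquiv.toMatrix := rfl
  have h2 : (weyl σ).val = (σ⁻¹).toPEquiv.toMatrix := rfl
  rw [Units.val_mul, Units.val_mul, h1, h2, PEquiv.toMatrix_toPEquiv_mul,
    PEquiv.mul_toMatrix_toPEquiv]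
  rfl

theorem mem_weylU_iff {n : ℕ} (σ : Equiv.Perm (Fin n)) (x : GL (Fin n) ℝ) :
    x ∈ weylU σ ↔ (∀ i, x.val i i = 1) ∧
      ∀ i j, i ≠ j → ¬ (i < j ∧ σ j < σ i) → x.val i j = 0 := by
  constructor
  · rintro ⟨⟨v, ⟨u, hu, hv⟩, rfl⟩, hx⟩
    refine ⟨hx.1, fun i j hij h => ?_⟩
    rcases lt_or_gt_of_ne hij with h1 | h1
    · have h2 : σ i < σ j :=
        lt_of_le_of_ne (not_lt.1 fun h2 => h ⟨h1, h2⟩) (fun h3 => hij (σ.injective h3))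
      rw [conj_val, hv, transpose_apply]
      exact hu.2 _ _ h2
    · exact hx.2 i j h1
  · rintro ⟨h1, h2⟩
    have hU : x ∈ unipotent n :=
      ⟨h1, fun i j hij => h2 i j hij.ne' fun h => lt_asymm h.1 hij⟩
    refine ⟨⟨weyl σ * x * (weyl σ)⁻¹, ?_, by group⟩, hU⟩
    set v : GL (Fin n) ℝ := weyl σ * x * (weyl σ)⁻¹ with hv
    have hxv : x = (weyl σ)⁻¹ * v * weyl σ := by rw [hv]; group
    have hvx : ∀ i j, v.val i j = x.val (σ.symm i) (σ.symm j) := by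
      intro i j
      have := conj_val σ v (σ.symm i) (σ.symm j)
      rw [← hxv] at this
      simpa using this.symm
    have hdiag : ∀ i, v.val i i = 1 := fun i => by rw [hvx, h1]
    have hup : ∀ i j, i < j → v.val i j = 0 := by
      intro i j hij
      rw [hvx]
      exact h2 _ _ (fun h => hij.ne (σ.symm.injective h))
        (fun h => by simpa using lt_asymm hij (by simpa using h.2))
    have hdet : IsUnit (v.val)ᵀ.det := by
      rw [det_transpose]; exact (Matrix.isUnit_iff_isUnit_det _).1 v.isUnit
    exact ⟨Matrix.nonsingInvUnit _ hdet,
      ⟨fun i => hdiag i, fun i j hij => hup j i hij⟩, by simp [Matrix.nonsingInvUnit]⟩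

/-- The matrix in `U_w(ℝ)` with prescribed coordinates. -/
def coordMatrix {n : ℕ} (σ : Equiv.Perm (Fin n)) (t : Inversion σ → ℝ) :
    Matrix (Fin n) (Fin n) ℝ := fun i j =>
  if h : i < j ∧ σ j < σ i then t ⟨(i, j), h⟩ else if i = j then 1 else 0

theorem det_coordMatrix {n : ℕ} (σ : Equiv.Perm (Fin n)) (t : Inversion σ → ℝ) :
    (coordMatrix σ t).det = 1 := by
  rw [Matrix.det_of_isUpperTriangular]
  · exact Finset.prod_eq_one fun i _ => by simp [coordMatrix]
  · intro i j hij
    have hij : j < i := hij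
    simp [coordMatrix, hij.ne', hij.not_gt]

theorem continuous_coordMatrix {n : ℕ} (σ : Equiv.Perm (Fin n)) :
    Continuous (coordMatrix σ) := by
  refine continuous_pi fun i => continuous_pi fun j => ?_
  unfold coordMatrix
  split_ifs <;> fun_prop

/-- The coordinates `(x_{ij})` on `U_w(ℝ)` identify it with a Euclidean space. -/
def coord {n : ℕ} (σ : Equiv.Perm (Fin n)) : weylU σ ≃ₜ (Inversion σ → ℝ) where
  toFun x p := x.1.val p.1.1 p.1.2
  invFun t := ⟨⟨coordMatrix σ t, (coordMatrix σ t).adjugate,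
      by rw [mul_adjugate, det_coordMatrix, one_smul],
      by rw [adjugate_mul, det_coordMatrix, one_smul]⟩, by
    rw [mem_weylU_iff]
    exact ⟨fun i => by simp [coordMatrix], fun i j hij h => by simp [coordMatrix, hij, h]⟩⟩
  left_inv x := by
    have hx := (mem_weylU_iff σ x.1).1 x.2
    refine Subtype.ext (Units.ext (Matrix.ext fun i j => ?_))
    change coordMatrix σ (fun p => x.1.val p.1.1 p.1.2) i j = x.1.val i j
    unfold coordMatrix
    split_ifs with h1 h2
    · rfl
    · subst h2; exact (hx.1 i).symm
    · exact (hx.2 i j h2 h1).symm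
  right_inv t := by
    funext p
    change coordMatrix σ t p.1.1 p.1.2 = t p
    simp [coordMatrix, p.2]
  continuous_toFun :=
    continuous_pi fun p => (Units.continuous_val.comp continuous_subtype_val).matrix_elem _ _
  continuous_invFun := by
    refine Continuous.subtype_mk (Units.continuous_iff.2 ⟨?_, ?_⟩) _
    · exact continuous_coordMatrix σ
    · exact (continuous_coordMatrix σ).matrix_adjugate

instance {n : ℕ} (σ : Equiv.Perm (Fin n)) : MeasurableSpace (weylU σ) := borel _

instance {n : ℕ} (σ : Equiv.Perm (Fin n)) : BorelSpace (weylU σ) := ⟨rfl⟩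

/-- The measure `dx = ∏ dx_{ij}` on `U_w(ℝ)`, the product being over the coordinates
of `U_w(ℝ)`. -/
def weylMeasure {n : ℕ} (σ : Equiv.Perm (Fin n)) : Measure (weylU σ) :=
  (volume : Measure (Inversion σ → ℝ)).map (coord σ).symm

/-- The submatrix of `g` formed by its last `j` rows. -/
def lastRows {n : ℕ} (j : ℕ) (g : GL (Fin n) ℝ) : Matrix {i : Fin n // n ≤ i.val + j} (Fin n) ℝ :=
  g.val.submatrix Subtype.val id

/-- `Δ_j(g)`: the `j`-dimensional volume of the parallelepiped spanned by the last `j` rows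
of `g` in Euclidean space, i.e. the square root of their Gram determinant. -/
def Delta {n : ℕ} (j : ℕ) (g : GL (Fin n) ℝ) : ℝ :=
  √(lastRows j g * (lastRows j g)ᵀ).det

end WeylVolume

end

/-! By Markov's inequality it is enough that the integral of $\prod_{1\le
j<n}\Delta_j(wx)^{-(1+\epsilon)}$ over $U_w$ is finite: on the given set the integrand is at least
$(B_1\cdots B_{n-1})^{-(1+\epsilon)}$, and $W$ is finite (`weylMeasure_le`). This is a
Gindikin–Karpelevich integral, and it is reduced to one-variable integrals by induction on the
length of $w$ (`lintegral_weight_ne_top`).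

Let $g_j$ be the Gram determinant of the rows of index at least $j$, counted from 0, so that
$\Delta_j^2=g_{n-j}$. The integrand is embedded in the family of weights $\prod_k
(g_k/g_{k+1})^{c_k/2}\prod_j g_j^{-1/2}$. Let $w=sw'$ with $w'$ shorter and $s$ exchanging $i$ and
$i+1$. Then $U_w$ has one coordinate $t$ more than $U_{w'}$, and after a shear of determinant 1,
$wx$ arises from $w'x'$ by adding $t$ times row $i+1$ to row $i$ and exchanging the two rows
(`permRows_shear`). Only $g_{i+1}$ changes; it becomes a quadratic polynomial in $t$ with leading
coefficient the old $g_{i+1}$ and $AC-B^2=g_ig_{i+2}$. Completing the square, the $t$-integral is a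
constant, finite when $c_i>c_{i+1}$, times the weight with $c_i$ and $c_{i+1}$ exchanged
(`lintegral_weight_shearSwap`). The choice $c_k=-\epsilon k$ gives the required integrand and makes
every such constant finite. -/

namespace WeylVolume

/-! ### The one-variable integral -/

/-- The integral `∫ (1 + u²)^{-(1+s)/2} du`. -/
noncomputable def kernelIntegral (s : ℝ) : ENNReal :=
  ∫⁻ u : ℝ, ENNReal.ofReal (Real.exp (-(1 + s) / 2 * Real.log (1 + u ^ 2)))

theorem kernelIntegral_ne_top {s : ℝ} (hs : 0 < s) : kernelIntegral s ≠ ⊤ := by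
  have h := (integrable_rpow_neg_one_add_norm_sq (E := ℝ) (μ := volume) (r := 1 + s)
    (by simpa using hs)).lintegral_lt_top.ne
  refine ne_of_eq_of_ne (lintegral_congr fun u => ?_) h
  rw [Real.norm_eq_abs, sq_abs, Real.rpow_def_of_pos (by positivity), mul_comm]

theorem lintegral_comp_affine (f : ℝ → ENNReal) (hf : Measurable f) {r : ℝ} (hr : 0 < r) (b : ℝ) :
    ∫⁻ t, f (r * (t + b)) = ENNReal.ofReal r⁻¹ * ∫⁻ u, f u := by
  rw [lintegral_add_right_eq_self (fun t => f (r * t)) b,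
    ← lintegral_map (f := f) (g := fun t => r * t) hf (by fun_prop),
    Real.map_volume_mul_left hr.ne', lintegral_smul_measure, abs_of_pos (inv_pos.2 hr),
    smul_eq_mul]

/-- Completing the square turns the quadratic into $D(1+r^2(t+B/C)^2)$ with $D=(AC-B^2)/C$ and
$r^2=C/D$; an affine substitution then leaves the kernel integral. -/
theorem lintegral_quadratic (s : ℝ) {A B C : ℝ} (hC : 0 < C) (hD : 0 < A * C - B ^ 2) :
    ∫⁻ t : ℝ, ENNReal.ofReal (Real.exp (-(1 + s) / 2 * Real.log (A + 2 * B * t + C * t ^ 2))) =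
      kernelIntegral s * ENNReal.ofReal
        (Real.exp (-s / 2 * (Real.log (A * C - B ^ 2) - Real.log C) - Real.log C / 2)) := by
  set D : ℝ := (A * C - B ^ 2) / C with hDdef
  have hDpos : 0 < D := div_pos hD hC
  set r : ℝ := Real.exp ((Real.log C - Real.log D) / 2) with hr
  have hr2 : r ^ 2 = C / D := by
    rw [hr, ← Real.exp_nat_mul, ← Real.log_div hC.ne' hDpos.ne']
    push_cast
    rw [mul_div_cancel₀ _ two_ne_zero, Real.exp_log (div_pos hC hDpos)]
  have hlog : ∀ t : ℝ, Real.log (A + 2 * B * t + C * t ^ 2) =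
      Real.log D + Real.log (1 + (r * (t + B / C)) ^ 2) := by
    intro t
    rw [← Real.log_mul hDpos.ne' (by positivity), mul_pow, hr2]
    congr 1
    rw [mul_add, mul_one, ← mul_assoc, mul_div_cancel₀ _ hDpos.ne', hDdef]
    field_simp
    ring
  have hlogD : Real.log (A * C - B ^ 2) - Real.log C = Real.log D := by
    rw [hDdef, Real.log_div hD.ne' hC.ne']
  have hexp : ∀ t : ℝ, ENNReal.ofReal
      (Real.exp (-(1 + s) / 2 * Real.log (A + 2 * B * t + C * t ^ 2))) =
      ENNReal.ofReal (Real.exp (-(1 + s) / 2 * Real.log D)) *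
        ENNReal.ofReal (Real.exp (-(1 + s) / 2 * Real.log (1 + (r * (t + B / C)) ^ 2))) := by
    intro t
    rw [hlog, mul_add, Real.exp_add, ENNReal.ofReal_mul (Real.exp_pos _).le]
  simp_rw [hexp]
  rw [lintegral_const_mul _ (by fun_prop), lintegral_comp_affine
    (fun u => ENNReal.ofReal (Real.exp (-(1 + s) / 2 * Real.log (1 + u ^ 2)))) (by fun_prop)
    (Real.exp_pos _), hlogD, ← mul_assoc, ← ENNReal.ofReal_mul (Real.exp_pos _).le,
    ← Real.exp_neg, ← Real.exp_add, mul_comm, kernelIntegral]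
  congr 3
  ring

/-! ### Gram determinants and Schur complements -/

section Gram

variable {ι κ : Type*} [Fintype ι] [DecidableEq ι] {m : Type*} [Fintype m] [DecidableEq m]

/-- The Gram form of vectors modulo the span of the rows of `V`. -/
noncomputable def schurForm (V : Matrix ι m ℝ) : Matrix m m ℝ := 1 - Vᵀ * (V * Vᵀ)⁻¹ * V

theorem schurForm_transpose (V : Matrix ι m ℝ) : (schurForm V)ᵀ = schurForm V := by
  simp [schurForm, transpose_nonsing_inv, Matrix.mul_assoc]

/-- Schur complement of the block $VV^\top$. When this block is invertible, `schurForm V` is the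
orthogonal projection onto the complement of the row space of $V$. -/
theorem det_gram_fromRows [Fintype κ] [DecidableEq κ] (V : Matrix ι m ℝ) (W : Matrix κ m ℝ)
    (hV : (V * Vᵀ).det ≠ 0) :
    (fromRows V W * (fromRows V W)ᵀ).det = (V * Vᵀ).det * (W * schurForm V * Wᵀ).det := by
  rw [transpose_fromRows, fromRows_mul_fromCols]
  have : Invertible (V * Vᵀ) := invertibleOfIsUnitDet _ (isUnit_iff_ne_zero.2 hV)
  rw [det_fromBlocks₁₁, invOf_eq_nonsing_inv, schurForm]
  congr 2
  simp only [Matrix.mul_sub, Matrix.sub_mul, Matrix.mul_one, Matrix.mul_assoc]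

theorem mul_schurForm_mul_apply (V : Matrix ι m ℝ) (W : Matrix κ m ℝ) (a b : κ) :
    (W * schurForm V * Wᵀ) a b = W a ⬝ᵥ schurForm V *ᵥ W b := by
  rw [Matrix.mul_assoc, mul_apply']
  rfl

theorem schurForm_comm (V : Matrix ι m ℝ) (p q : m → ℝ) :
    p ⬝ᵥ schurForm V *ᵥ q = q ⬝ᵥ schurForm V *ᵥ p := by
  rw [dotProduct_mulVec, ← mulVec_transpose, schurForm_transpose, dotProduct_comm]

end Gram

variable {n : ℕ}

/-- The rows of `y` of index at least `i`. -/
abbrev tailRows (i : ℕ) (y : Matrix (Fin n) (Fin n) ℝ) :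
    Matrix {k : Fin n // i ≤ k.val} (Fin n) ℝ := y.submatrix Subtype.val id

/-- The Gram determinant of the rows of `y` of index at least `i`. -/
noncomputable def gramTail (i : ℕ) (y : Matrix (Fin n) (Fin n) ℝ) : ℝ :=
  (tailRows i y * (tailRows i y)ᵀ).det

theorem gramTail_pos (i : ℕ) {y : Matrix (Fin n) (Fin n) ℝ} (hy : y.det ≠ 0) :
    0 < gramTail i y := by
  have hli : LinearIndependent ℝ y.row := by
    rw [Matrix.linearIndependent_rows_iff_isUnit, Matrix.isUnit_iff_isUnit_det]
    exact isUnit_iff_ne_zero.2 hy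
  have h : Function.Injective (tailRows i y).vecMul :=
    Matrix.vecMul_injective_iff.2 (hli.comp Subtype.val Subtype.val_injective)
  have := (PosDef.mul_conjTranspose_self (tailRows i y) h).det_pos
  rwa [conjTranspose_eq_transpose_of_trivial] at this

theorem gramTail_congr {i : ℕ} {y z : Matrix (Fin n) (Fin n) ℝ}
    (h : ∀ k : Fin n, i ≤ k.val → y k = z k) : gramTail i y = gramTail i z := by
  have : tailRows i y = tailRows i z := by
    ext k l
    exact congrFun (h k.1 k.2) l
  rw [gramTail, gramTail, this]

theorem gramTail_zero (y : Matrix (Fin n) (Fin n) ℝ) : gramTail 0 y = y.det ^ 2 := by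
  let e : Fin n ≃ {k : Fin n // 0 ≤ k.val} := (Equiv.subtypeUnivEquiv fun _ => Nat.zero_le _).symm
  rw [gramTail, ← det_submatrix_equiv_self e]
  have : (tailRows 0 y * (tailRows 0 y)ᵀ).submatrix e e = y * yᵀ := rfl
  rw [this, det_mul, det_transpose, sq]

theorem gramTail_of_le {i : ℕ} (hi : n ≤ i) (y : Matrix (Fin n) (Fin n) ℝ) : gramTail i y = 1 := by
  have : IsEmpty {k : Fin n // i ≤ k.val} := ⟨fun k => absurd k.2 (by have := k.1.2; omega)⟩
  exact det_isEmpty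

/-- Here `f` enumerates the rows from $i$ to $j-1$. Using it with one and with two rows expresses
$g_{i+1}$ and $g_i$ through the same quadratic form modulo the rows from $i+2$ on. -/
theorem gramTail_eq_of_equiv {i j : ℕ} {κ : Type*} [Fintype κ] [DecidableEq κ]
    (y : Matrix (Fin n) (Fin n) ℝ) (hy : y.det ≠ 0) (f : κ → Fin n)
    (hf : Function.Injective f) (hfj : ∀ a, f a < j) (hij : i ≤ j)
    (hfi : ∀ k : Fin n, i ≤ k.val ∧ k.val < j ↔ ∃ a, f a = k) :
    gramTail i y = gramTail j y *
      (y.submatrix f id * schurForm (tailRows j y) * (y.submatrix f id)ᵀ).det := by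
  have hfi' : ∀ a, i ≤ (f a).val := fun a => ((hfi _).2 ⟨a, rfl⟩).1
  let g : {k : Fin n // j ≤ k.val} ⊕ κ → {k : Fin n // i ≤ k.val} :=
    Sum.elim (fun k => ⟨k.1, hij.trans k.2⟩) (fun a => ⟨f a, hfi' a⟩)
  have hg : Function.Bijective g := by
    constructor
    · rintro (a | a) (b | b) h <;> simp only [g, Sum.elim_inl, Sum.elim_inr, Subtype.mk.injEq] at h
      · rw [Subtype.ext h]
      · exact absurd (h ▸ a.2) (not_le.2 (hfj b))
      · exact absurd (h ▸ b.2) (not_le.2 (hfj a))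
      · rw [hf h]
    · rintro ⟨k, hk⟩
      by_cases hkj : j ≤ k.val
      · exact ⟨Sum.inl ⟨k, hkj⟩, rfl⟩
      · obtain ⟨a, rfl⟩ := (hfi k).1 ⟨hk, not_le.1 hkj⟩
        exact ⟨Sum.inr a, rfl⟩
  let e := Equiv.ofBijective g hg
  rw [gramTail, ← det_submatrix_equiv_self e, gramTail,
    ← det_gram_fromRows _ _ (gramTail_pos j hy).ne']
  have : (tailRows i y).submatrix e id = fromRows (tailRows j y) (y.submatrix f id) := by
    ext (a | a) b <;> rfl
  rw [← this]
  rfl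

theorem gramTail_one_row {i : ℕ} (hi : i < n) (y : Matrix (Fin n) (Fin n) ℝ) (hy : y.det ≠ 0) :
    gramTail i y = gramTail (i + 1) y *
      (y ⟨i, hi⟩ ⬝ᵥ schurForm (tailRows (i + 1) y) *ᵥ y ⟨i, hi⟩) := by
  rw [gramTail_eq_of_equiv (j := i + 1) y hy (fun _ : Unit => (⟨i, hi⟩ : Fin n))
    (fun _ _ _ => rfl) (fun _ => by simp) (by simp)
    (fun k => by simp only [Fin.ext_iff, exists_const]; omega), det_unique, mul_schurForm_mul_apply]
  rfl

theorem gramTail_two_rows {i : ℕ} (hi : i + 1 < n) (y : Matrix (Fin n) (Fin n) ℝ)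
    (hy : y.det ≠ 0) (p q : Fin n → ℝ) (hp : y ⟨i, by omega⟩ = p) (hq : y ⟨i + 1, hi⟩ = q) :
    gramTail i y = gramTail (i + 2) y *
      ((p ⬝ᵥ schurForm (tailRows (i + 2) y) *ᵥ p) * (q ⬝ᵥ schurForm (tailRows (i + 2) y) *ᵥ q) -
        (p ⬝ᵥ schurForm (tailRows (i + 2) y) *ᵥ q) ^ 2) := by
  subst hp hq
  let f : Fin 2 → Fin n := fun a => ⟨i + a.val, by omega⟩
  rw [gramTail_eq_of_equiv (j := i + 2) y hy f
    (fun a b h => by simpa [f, Fin.ext_iff] using h) (fun a => by simp only [f]; omega)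
    (by simp)
    (fun k => ⟨fun h => ⟨⟨k.val - i, by omega⟩, by simp only [f, Fin.ext_iff]; omega⟩, by
      rintro ⟨a, rfl⟩; simp only [f]; omega⟩), det_fin_two]
  simp only [mul_schurForm_mul_apply]
  have h0 : y.submatrix f id 0 = y ⟨i, by omega⟩ := rfl
  have h1 : y.submatrix f id 1 = y ⟨i + 1, hi⟩ := rfl
  rw [h0, h1, schurForm_comm _ (y ⟨i + 1, hi⟩) (y ⟨i, _⟩), sq]

/-! ### Effect of a shear and a row exchange on Gram determinants -/

/-- Exchanging the rows `i` and `i + 1` of `y` after adding `t` times the latter to the former. -/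
def shearSwap {i : ℕ} (hi : i + 1 < n) (t : ℝ) (y : Matrix (Fin n) (Fin n) ℝ) :
    Matrix (Fin n) (Fin n) ℝ := fun k =>
  if k.val = i then y ⟨i + 1, hi⟩
  else if k.val = i + 1 then y ⟨i, by omega⟩ + t • y ⟨i + 1, hi⟩ else y k

/-- For $j\le i$ both altered rows belong to the tail, which changes by a transvection and a
permutation; for $j\ge i+2$ neither does. -/
theorem gramTail_shearSwap {i : ℕ} (hi : i + 1 < n) (t : ℝ) (y : Matrix (Fin n) (Fin n) ℝ)
    {j : ℕ} (hj : j ≠ i + 1) : gramTail j (shearSwap hi t y) = gramTail j y := by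
  rcases lt_or_gt_of_ne hj with h | h
  · have hji : j ≤ i := by omega
    let a : {k : Fin n // j ≤ k.val} := ⟨⟨i, by omega⟩, hji⟩
    let b : {k : Fin n // j ≤ k.val} := ⟨⟨i + 1, hi⟩, by simp; omega⟩
    have hab : a ≠ b := by simp [a, b]
    have hrows : tailRows j (shearSwap hi t y) =
        (transvection a b t * tailRows j y).submatrix (Equiv.swap a b) id := by
      ext k l
      rw [submatrix_apply, transvection, Matrix.add_mul, Matrix.one_mul, Matrix.add_apply]
      by_cases hka : k = a
      · subst hka
        rw [Equiv.swap_apply_left, single_mul_apply_of_ne (h := hab.symm)]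
        simp [shearSwap, a, b]
      · by_cases hkb : k = b
        · subst hkb
          rw [Equiv.swap_apply_right, single_mul_apply_same]
          simp [shearSwap, a, b]
        · rw [Equiv.swap_apply_of_ne_of_ne hka hkb, single_mul_apply_of_ne (h := hka)]
          have h1 : k.1.val ≠ i := fun h => hka (Subtype.ext (Fin.ext h))
          have h2 : k.1.val ≠ i + 1 := fun h => hkb (Subtype.ext (Fin.ext h))
          simp [shearSwap, h1, h2]
    set E := transvection a b t with hE
    have hdet : E.det = 1 := det_transvection_of_ne _ _ hab t
    rw [gramTail, hrows, gramTail]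
    have : (E * tailRows j y).submatrix (Equiv.swap a b) id *
        ((E * tailRows j y).submatrix (Equiv.swap a b) id)ᵀ =
        (E * (tailRows j y * (tailRows j y)ᵀ) * Eᵀ).submatrix (Equiv.swap a b)
          (Equiv.swap a b) := by
      have h2 : E * (tailRows j y * (tailRows j y)ᵀ) * Eᵀ =
          (E * tailRows j y) * (E * tailRows j y)ᵀ := by
        rw [transpose_mul]; simp only [Matrix.mul_assoc]
      rw [h2]
      rfl
    rw [this, det_submatrix_equiv_self, det_mul, det_mul, det_transpose, hdet, one_mul, mul_one]
  · refine gramTail_congr fun k hk => ?_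
    simp only [shearSwap]
    rw [if_neg (by omega), if_neg (by omega)]

theorem det_shearSwap_ne_zero {i : ℕ} (hi : i + 1 < n) (t : ℝ) {y : Matrix (Fin n) (Fin n) ℝ}
    (hy : y.det ≠ 0) : (shearSwap hi t y).det ≠ 0 := by
  have h := gramTail_shearSwap hi t y (j := 0) (by omega)
  rw [gramTail_zero, gramTail_zero] at h
  intro h0
  rw [h0] at h
  exact pow_ne_zero 2 hy (by rw [← h]; ring)

/-- Modulo the rows from $i+2$ on, the new row $i+1$ is $p+tq$, whose squared length is quadratic in
$t$. The discriminant is the $2\times2$ Gram determinant of $p,q$, which up to powers of $g_{i+2}$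
is $g_i$. -/
theorem exists_gramTail_shearSwap {i : ℕ} (hi : i + 1 < n) {y : Matrix (Fin n) (Fin n) ℝ}
    (hy : y.det ≠ 0) : ∃ A B : ℝ,
      (∀ t, gramTail (i + 1) (shearSwap hi t y) = A + 2 * B * t + gramTail (i + 1) y * t ^ 2) ∧
      A * gramTail (i + 1) y - B ^ 2 = gramTail i y * gramTail (i + 2) y := by
  set p := y ⟨i, by omega⟩ with hp
  set q := y ⟨i + 1, hi⟩ with hq
  set S := schurForm (tailRows (i + 2) y) with hS
  refine ⟨gramTail (i + 2) y * (p ⬝ᵥ S *ᵥ p), gramTail (i + 2) y * (p ⬝ᵥ S *ᵥ q), fun t => ?_, ?_⟩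
  · have h2 : ∀ k : Fin n, i + 2 ≤ k.val → shearSwap hi t y k = y k := fun k hk => by
      simp only [shearSwap]
      rw [if_neg (by omega), if_neg (by omega)]
    have h3 : tailRows (i + 2) (shearSwap hi t y) = tailRows (i + 2) y := by
      ext k l
      exact congrFun (h2 k.1 k.2) l
    have h1 : shearSwap hi t y ⟨i + 1, hi⟩ = p + t • q := by simp [shearSwap, p, q]
    rw [gramTail_one_row hi _ (det_shearSwap_ne_zero hi t hy), gramTail_one_row hi y hy,
      show i + 1 + 1 = i + 2 from rfl, h3, h1, gramTail_congr h2, ← hS, ← hq]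
    simp only [mulVec_add, mulVec_smul, add_dotProduct, dotProduct_add, smul_dotProduct,
      dotProduct_smul, smul_eq_mul]
    rw [hS, schurForm_comm _ q p]
    ring
  · rw [gramTail_one_row hi y hy, gramTail_two_rows hi y hy p q rfl rfl,
      show i + 1 + 1 = i + 2 from rfl, ← hS, ← hq]
    ring

/-! ### Shears and splitting off a coordinate -/

section Measure

/-- The determinant is the value at 1 of the characteristic polynomial of the nilpotent map $-N$, a
power of $X$. -/
theorem det_one_add_of_sq_eq_zero {E : Type*} [AddCommGroup E] [Module ℝ E]
    [FiniteDimensional ℝ E] (N : E →ₗ[ℝ] E) (hN : N ∘ₗ N = 0) :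
    LinearMap.det (LinearMap.id + N) = 1 := by
  have hnil : IsNilpotent (-N) := ⟨2, by rw [sq, neg_mul_neg]; exact hN⟩
  have h := LinearMap.eval_charpoly (-N) 1
  rw [hnil.charpoly_eq_X_pow_finrank] at h
  simp only [Polynomial.eval_pow, Polynomial.eval_X, one_pow, map_one, sub_neg_eq_add] at h
  exact h.symm

theorem lintegral_shear {ι : Type*} [Fintype ι] (N : (ι → ℝ) →ₗ[ℝ] ι → ℝ) (hN : N ∘ₗ N = 0)
    (f : (ι → ℝ) → ENNReal) (hf : Measurable f) :
    ∫⁻ x, f (x + N x) = ∫⁻ x, f x := by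
  have hdet := det_one_add_of_sq_eq_zero N hN
  have hmap := Measure.map_linearMap_addHaar_eq_smul_addHaar (volume : Measure (ι → ℝ))
    (f := LinearMap.id + N) (by rw [hdet]; exact one_ne_zero)
  rw [hdet, inv_one, abs_one, ENNReal.ofReal_one, one_smul] at hmap
  conv_rhs => rw [← hmap]
  rw [lintegral_map hf (LinearMap.continuous_of_finiteDimensional _).measurable]
  rfl

theorem lintegral_option {ι κ : Type*} [Fintype ι] [Fintype κ] (e : Option ι ≃ κ)
    (f : (κ → ℝ) → ENNReal) (hf : Measurable f) :
    ∫⁻ z, f z = ∫⁻ t : ℝ, ∫⁻ x : ι → ℝ, f (fun k => (e.symm k).elim t x) := by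
  have h1 := (volume_measurePreserving_piCongrLeft (fun _ : κ => ℝ) e).lintegral_comp hf
  have h2 : MeasurePreserving (MeasurableEquiv.piOptionEquivProd fun _ : Option ι => ℝ).symm
      ((volume : Measure (ι → ℝ)).prod (volume : Measure ℝ)) volume :=
    ⟨MeasurableEquiv.measurable _, Measure.pi_map_piOptionEquivProd fun _ => volume⟩
  have hm : Measurable fun z : Option ι → ℝ =>
      f (MeasurableEquiv.piCongrLeft (fun _ : κ => ℝ) e z) :=
    hf.comp (MeasurableEquiv.measurable _)
  have hc : Measurable fun q : (ι → ℝ) × ℝ => f (fun k => (e.symm k).elim q.2 q.1) := by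
    refine hf.comp (measurable_pi_lambda _ fun k => ?_)
    cases e.symm k <;> simp only [Option.elim] <;> fun_prop
  rw [← h1, ← h2.lintegral_comp hm]
  have hfun : ∀ q : (ι → ℝ) × ℝ, f (MeasurableEquiv.piCongrLeft (fun _ : κ => ℝ) e
      ((MeasurableEquiv.piOptionEquivProd fun _ : Option ι => ℝ).symm q)) =
      f (fun k => (e.symm k).elim q.2 q.1) := by
    intro q
    congr 1
    funext k
    obtain ⟨o, rfl⟩ := e.surjective k
    rw [MeasurableEquiv.piCongrLeft_apply_apply, Equiv.symm_apply_apply]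
    cases o <;> rfl
  simp_rw [hfun]
  exact lintegral_prod_symm' _ hc

end Measure

/-! ### The weights and the rank-one integral -/

section Weight

/-- The exponent, in terms of logarithms `l j` of Gram determinants, of the weight attached
to `c`. -/
noncomputable def weightExponent (n : ℕ) (c l : ℕ → ℝ) : ℝ :=
  (∑ k ∈ Finset.range n, c k * (l k - l (k + 1)) - ∑ j ∈ Finset.range (n + 1), l j) / 2

/-- Only the terms $k=i,i+1$ see the change. The remainder isolates the $t$-dependent quantity `l'
(i + 1)` with coefficient $-(1+s)/2$, $s=c_i-c_{i+1}$, the exponent in the kernel integral. -/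
theorem weightExponent_swap {n i : ℕ} (hi : i + 1 < n) (c l l' : ℕ → ℝ)
    (h : ∀ j, j ≠ i + 1 → l' j = l j) :
    weightExponent n c l' = weightExponent n (c ∘ Equiv.swap i (i + 1)) l +
      (((c i - c (i + 1)) * (l i + l (i + 2) - l (i + 1)) + l (i + 1)) / 2 +
      -(1 + (c i - c (i + 1))) / 2 * l' (i + 1)) := by
  have h1 : ∑ k ∈ Finset.range n, (c k * (l' k - l' (k + 1)) -
      (c ∘ Equiv.swap i (i + 1)) k * (l k - l (k + 1))) =
      (c i * (l' i - l' (i + 1)) - c (i + 1) * (l i - l (i + 1))) +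
      (c (i + 1) * (l' (i + 1) - l' (i + 2)) - c i * (l (i + 1) - l (i + 2))) := by
    rw [Finset.sum_eq_add_of_mem i (i + 1) (by simp; omega) (by simp; omega) (by omega)]
    · simp
    · intro k _ hk
      rw [Function.comp_apply, Equiv.swap_apply_of_ne_of_ne hk.1 hk.2, h k hk.2,
        h (k + 1) (by omega), sub_self]
  have h2 : ∑ j ∈ Finset.range (n + 1), (l' j - l j) = l' (i + 1) - l (i + 1) :=
    Finset.sum_eq_single_of_mem _ (by simp; omega) fun j _ hj => by rw [h j hj, sub_self]
  rw [Finset.sum_sub_distrib] at h1 h2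
  rw [h i (by omega), h (i + 2) (by omega)] at h1
  unfold weightExponent
  linear_combination h1 / 2 - h2 / 2

/-- Summation by parts; both boundary terms vanish. -/
theorem weightExponent_linear {n : ℕ} (ε : ℝ) (l : ℕ → ℝ) (h0 : l 0 = 0) (hn : l n = 0) :
    weightExponent n (fun k => -ε * k) l = -(1 + ε) / 2 * ∑ k ∈ Finset.range n, l (k + 1) := by
  have h1 : ∀ m : ℕ, ∑ k ∈ Finset.range m, (-ε * k) * (l k - l (k + 1)) =
      -ε * (∑ k ∈ Finset.range m, l (k + 1) - m * l m) := by
    intro m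
    induction m with
    | zero => simp
    | succ m ih =>
      rw [Finset.sum_range_succ, ih, Finset.sum_range_succ]
      push_cast
      ring
  rw [weightExponent, h1, Finset.sum_range_succ', h0, hn]
  ring

/-- The product of powers of Gram determinants `∏ (g_k / g_{k+1})^{c_k / 2} ∏ g_j^{-1/2}`. -/
noncomputable def weight (c : ℕ → ℝ) (y : Matrix (Fin n) (Fin n) ℝ) : ℝ :=
  Real.exp (weightExponent n c fun j => Real.log (gramTail j y))

theorem lintegral_weight_shearSwap {i : ℕ} (hi : i + 1 < n) (c : ℕ → ℝ)
    {y : Matrix (Fin n) (Fin n) ℝ} (hy : y.det ≠ 0) :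
    ∫⁻ t : ℝ, ENNReal.ofReal (weight c (shearSwap hi t y)) =
      kernelIntegral (c i - c (i + 1)) *
        ENNReal.ofReal (weight (c ∘ Equiv.swap i (i + 1)) y) := by
  obtain ⟨A, B, hquad, hdisc⟩ := exists_gramTail_shearSwap hi hy
  have hg := fun j => gramTail_pos j hy
  set s := c i - c (i + 1) with hs
  set R := ((s * (Real.log (gramTail i y) + Real.log (gramTail (i + 2) y) -
    Real.log (gramTail (i + 1) y)) + Real.log (gramTail (i + 1) y)) / 2) with hR
  have hw : ∀ t, ENNReal.ofReal (weight c (shearSwap hi t y)) =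
      ENNReal.ofReal (weight (c ∘ Equiv.swap i (i + 1)) y * Real.exp R) *
      ENNReal.ofReal (Real.exp (-(1 + s) / 2 *
        Real.log (A + 2 * B * t + gramTail (i + 1) y * t ^ 2))) := by
    intro t
    rw [weight, weightExponent_swap hi c (fun j => Real.log (gramTail j y))
      (fun j => Real.log (gramTail j (shearSwap hi t y)))
      (fun j hj => by rw [gramTail_shearSwap hi t y hj]), hquad, Real.exp_add, Real.exp_add,
      ← mul_assoc, ENNReal.ofReal_mul (by positivity)]
    rfl
  simp_rw [hw]
  rw [lintegral_const_mul _ (by fun_prop), lintegral_quadratic s (hg (i + 1))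
    (by rw [hdisc]; exact mul_pos (hg _) (hg _)), hdisc, mul_left_comm,
    ← ENNReal.ofReal_mul (by unfold weight; positivity), mul_assoc, ← Real.exp_add,
    Real.log_mul (hg _).ne' (hg _).ne', hR]
  congr 2
  -- The normalization $\prod_j g_j^{-1/2}$ (the $\rho$-shift) makes the factor from completing the
  -- square cancel $e^R$ exactly.
  convert mul_one _
  rw [Real.exp_eq_one_iff]
  ring

end Weight

/-! ### The matrices $wx$ in coordinates -/

/-- The matrix `w x`, where `w` is the Weyl element of `σ` and `x ∈ U_w` has coordinates `z`. -/
def permRows (σ : Equiv.Perm (Fin n)) (z : Inversion σ → ℝ) : Matrix (Fin n) (Fin n) ℝ :=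
  (coordMatrix σ z).submatrix σ.symm id

theorem permRows_eq (σ : Equiv.Perm (Fin n)) (z : Inversion σ → ℝ) :
    (weyl σ * ((coord σ).symm z).val).val = permRows σ z := by
  rw [Units.val_mul]
  change (σ⁻¹).toPEquiv.toMatrix * coordMatrix σ z = _
  rw [PEquiv.toMatrix_toPEquiv_mul]
  rfl

theorem det_permRows_ne_zero (σ : Equiv.Perm (Fin n)) (z : Inversion σ → ℝ) :
    (permRows σ z).det ≠ 0 := by
  rw [permRows, det_permute, det_coordMatrix, mul_one]
  exact_mod_cast Units.ne_zero _

theorem continuous_permRows (σ : Equiv.Perm (Fin n)) : Continuous (permRows σ) :=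
  (continuous_coordMatrix σ).matrix_submatrix _ _

theorem measurable_weight (c : ℕ → ℝ) {α : Type*} [MeasurableSpace α] [TopologicalSpace α]
    [BorelSpace α] {f : α → Matrix (Fin n) (Fin n) ℝ} (hf : Continuous f) :
    Measurable fun a => ENNReal.ofReal (weight c (f a)) := by
  have hg : ∀ j, Measurable fun a => gramTail j (f a) := fun j => by
    have hr : Continuous fun a => tailRows j (f a) := hf.matrix_submatrix _ _
    exact (hr.matrix_mul hr.matrix_transpose).matrix_det.measurable
  unfold weight weightExponent
  fun_prop

/-! ### Removing one simple reflection -/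

section Step

variable {σ : Equiv.Perm (Fin n)} {a b : Fin n} {i : ℕ}

theorem swap_lt_swap (hi : i + 1 < n) {u v : Fin n} (h : ¬ (u.val = i ∧ v.val = i + 1))
    (huv : u < v) : Equiv.swap (⟨i, by omega⟩ : Fin n) ⟨i + 1, hi⟩ u <
      Equiv.swap (⟨i, by omega⟩ : Fin n) ⟨i + 1, hi⟩ v := by
  rw [Equiv.swap_apply_def, Equiv.swap_apply_def]
  simp only [Fin.ext_iff]
  rw [Fin.lt_def] at huv ⊢
  split_ifs <;> (try dsimp only) <;> omega

/-- The permutation `s σ`, where `s` exchanges `i` and `i + 1`. -/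
def swapMul (hi : i + 1 < n) (σ : Equiv.Perm (Fin n)) : Equiv.Perm (Fin n) :=
  Equiv.swap (⟨i, by omega⟩ : Fin n) ⟨i + 1, hi⟩ * σ

/-- Exchanging the adjacent values $i,i+1$ preserves the order of every other pair of values, so
exactly the inversion $(a,b)$ is lost. -/
theorem swapMul_inversion_iff (hi : i + 1 < n) (ha : σ a = ⟨i + 1, hi⟩)
    (hb : σ b = ⟨i, by omega⟩) (hab : a < b) (p : Fin n × Fin n) :
    (p.1 < p.2 ∧ swapMul hi σ p.2 < swapMul hi σ p.1) ↔
      (p.1 < p.2 ∧ σ p.2 < σ p.1) ∧ p ≠ (a, b) := by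
  have hane : ∀ c, (σ c).val = i + 1 → c = a := fun c h => σ.injective (by rw [ha]; exact Fin.ext h)
  have hbne : ∀ c, (σ c).val = i → c = b := fun c h => σ.injective (by rw [hb]; exact Fin.ext h)
  rcases p with ⟨c, d⟩
  constructor
  · rintro ⟨h1, h2⟩
    have h3 := swap_lt_swap hi (u := swapMul hi σ d) (v := swapMul hi σ c) ?_ h2
    · simp only [swapMul, Equiv.Perm.mul_apply, Equiv.swap_apply_self] at h3
      refine ⟨⟨h1, h3⟩, fun h => ?_⟩
      obtain ⟨rfl, rfl⟩ := Prod.mk.inj h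
      simp [swapMul, ha, hb, Fin.lt_def] at h2
    · rintro ⟨h4, h5⟩
      have h4' : swapMul hi σ d = ⟨i, by omega⟩ := Fin.ext h4
      have h5' : swapMul hi σ c = ⟨i + 1, hi⟩ := Fin.ext h5
      rw [swapMul, Equiv.Perm.mul_apply, Equiv.swap_apply_eq_iff, Equiv.swap_apply_left] at h4'
      rw [swapMul, Equiv.Perm.mul_apply, Equiv.swap_apply_eq_iff, Equiv.swap_apply_right] at h5'
      have hd := hane d (congrArg Fin.val h4')
      have hc := hbne c (congrArg Fin.val h5')
      rw [hd, hc] at h1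
      exact lt_asymm h1 hab
  · rintro ⟨⟨h1, h2⟩, h3⟩
    refine ⟨h1, swap_lt_swap hi (fun h => h3 ?_) h2⟩
    rw [hane c h.2, hbne d h.1]

theorem swapMul_left (hi : i + 1 < n) (ha : σ a = ⟨i + 1, hi⟩) :
    swapMul hi σ a = ⟨i, by omega⟩ := by
  rw [swapMul, Equiv.Perm.mul_apply, ha, Equiv.swap_apply_right]

theorem swapMul_right (hi : i + 1 < n) (hb : σ b = ⟨i, by omega⟩) :
    swapMul hi σ b = ⟨i + 1, hi⟩ := by
  rw [swapMul, Equiv.Perm.mul_apply, hb, Equiv.swap_apply_left]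

/-- The inversions of `σ` are those of `s σ` and one more. -/
noncomputable def inversionEquiv (hi : i + 1 < n) (ha : σ a = ⟨i + 1, hi⟩)
    (hb : σ b = ⟨i, by omega⟩) (hab : a < b) :
    Option (Inversion (swapMul hi σ)) ≃ Inversion σ :=
  Equiv.ofBijective
    (fun o => o.elim ⟨(a, b), hab, by simp [ha, hb, Fin.lt_def]⟩
      fun p => ⟨p.1, ((swapMul_inversion_iff hi ha hb hab p.1).1 p.2).1⟩) (by
    constructor
    · rintro (_ | p) (_ | q) h <;> simp only [Option.elim, Subtype.mk.injEq] at h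
      · rfl
      · exact absurd h.symm ((swapMul_inversion_iff hi ha hb hab q.1).1 q.2).2
      · exact absurd h ((swapMul_inversion_iff hi ha hb hab p.1).1 p.2).2
      · rw [Subtype.ext h]
    · rintro ⟨p, hp⟩
      by_cases h : p = (a, b)
      · exact ⟨none, Subtype.ext h.symm⟩
      · exact ⟨some ⟨p, (swapMul_inversion_iff hi ha hb hab p).2 ⟨hp, h⟩⟩, rfl⟩)

/-- Moving the coordinates of the row `b` to the row `a`. -/
def rowShift (τ : Equiv.Perm (Fin n)) (a b : Fin n) :
    (Inversion τ → ℝ) →ₗ[ℝ] Inversion τ → ℝ where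
  toFun x p := if h : p.1.1 = a ∧ (b < p.1.2 ∧ τ p.1.2 < τ b) then x ⟨(b, p.1.2), h.2⟩ else 0
  map_add' x y := by
    funext p
    by_cases h : p.1.1 = a ∧ (b < p.1.2 ∧ τ p.1.2 < τ b) <;> simp [h]
  map_smul' r x := by
    funext p
    by_cases h : p.1.1 = a ∧ (b < p.1.2 ∧ τ p.1.2 < τ b) <;> simp [h]

theorem rowShift_comp_self (τ : Equiv.Perm (Fin n)) (hab : a ≠ b) :
    rowShift τ a b ∘ₗ rowShift τ a b = 0 := by
  ext x p
  simp [rowShift, hab.symm]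

/-- The new matrix is $x'$ with $t$ times row $b$ added to row $a$. Since $x'_{ab}=0$ and
$x'_{bb}=1$, its entry at $(a,b)$ is $t$; the rest of row $a$ is translated by $t$ times `rowShift`.
-/
theorem coordMatrix_shear (hi : i + 1 < n) (ha : σ a = ⟨i + 1, hi⟩)
    (hb : σ b = ⟨i, by omega⟩) (hab : a < b) (t : ℝ) (x : Inversion (swapMul hi σ) → ℝ)
    (c d : Fin n) :
    coordMatrix σ (fun k => ((inversionEquiv hi ha hb hab).symm k).elim t
      (x + (t • rowShift (swapMul hi σ) a b) x)) c d =
    if c = a then coordMatrix (swapMul hi σ) x a d + t * coordMatrix (swapMul hi σ) x b d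
    else coordMatrix (swapMul hi σ) x c d := by
  set z : Inversion σ → ℝ := fun k => ((inversionEquiv hi ha hb hab).symm k).elim t
      (x + (t • rowShift (swapMul hi σ) a b) x) with hz
  have hiff := swapMul_inversion_iff hi ha hb hab
  have hz0 : ∀ h, z ⟨(a, b), h⟩ = t := by
    intro h
    have : (⟨(a, b), h⟩ : Inversion σ) = inversionEquiv hi ha hb hab none := rfl
    rw [hz, this]
    simp only [Equiv.symm_apply_apply, Option.elim]
  have hz1 : ∀ p h h', z ⟨p, h⟩ = x ⟨p, h'⟩ + t * rowShift (swapMul hi σ) a b x ⟨p, h'⟩ := by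
    intro p h h'
    have : (⟨p, h⟩ : Inversion σ) = inversionEquiv hi ha hb hab (some ⟨p, h'⟩) := rfl
    rw [hz, this]
    simp only [Equiv.symm_apply_apply, Option.elim]
    rfl
  by_cases hcd : (c, d) = (a, b)
  · obtain ⟨rfl, rfl⟩ := Prod.mk.inj hcd
    have h1 : c < d ∧ σ d < σ c := ⟨hab, by simp [ha, hb, Fin.lt_def]⟩
    have h2 : ¬ (c < d ∧ swapMul hi σ d < swapMul hi σ c) := fun h => ((hiff (c, d)).1 h).2 rfl
    rw [if_pos rfl]
    have h3 : coordMatrix (swapMul hi σ) x c d = 0 := by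
      simp only [coordMatrix, h2, dif_neg, not_false_eq_true, hab.ne, if_false]
    rw [h3]
    simp [coordMatrix, h1, hz0]
  · by_cases h1 : c < d ∧ σ d < σ c
    · have h2 : c < d ∧ swapMul hi σ d < swapMul hi σ c := (hiff (c, d)).2 ⟨h1, hcd⟩
      have h3 : coordMatrix σ z c d = z ⟨(c, d), h1⟩ := by simp [coordMatrix, h1]
      have h4 : coordMatrix (swapMul hi σ) x c d = x ⟨(c, d), h2⟩ := by
        simp only [coordMatrix, h2, dif_pos, and_self]
      rw [h3, hz1 _ h1 h2]
      split_ifs with hca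
      · subst hca
        rw [h4]
        congr 2
        have hbd : b ≠ d := fun h => hcd (by rw [h])
        by_cases h5 : b < d ∧ swapMul hi σ d < swapMul hi σ b
        · simp only [rowShift, coordMatrix, LinearMap.coe_mk, AddHom.coe_mk, h5, and_self, dif_pos]
        · simp only [rowShift, coordMatrix, LinearMap.coe_mk, AddHom.coe_mk, h5, and_false,
            dif_neg, not_false_eq_true, hbd, if_false]
      · rw [h4]
        simp [rowShift, hca]
    · have h2 : ¬ (c < d ∧ swapMul hi σ d < swapMul hi σ c) := fun h => h1 ((hiff (c, d)).1 h).1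
      have h3 : coordMatrix σ z c d = if c = d then 1 else 0 := by simp [coordMatrix, h1]
      have h4 : coordMatrix (swapMul hi σ) x c d = if c = d then 1 else 0 := by
        simp only [coordMatrix, h2, dif_neg, not_false_eq_true]
      rw [h3]
      split_ifs with hcd' hca hca
      · subst hca hcd'
        rw [h4, if_pos rfl]
        simp [coordMatrix, hab.ne', hab.not_gt]
      · rw [h4, if_pos hcd']
      · subst hca
        have hbd : b ≠ d := fun h => hcd (by rw [h])
        -- Row $b$ has no coordinate outside the support of row $a$: as $s\sigma$ takes $a,b$ to
        -- $i,i+1$, a value below $i+1$ other than $i$ is below $i$, so $(a,d)$ would be an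
        -- inversion too.
        have h5 : ¬ (b < d ∧ swapMul hi σ d < swapMul hi σ b) := by
          rintro ⟨h5, h6⟩
          refine h2 ⟨hab.trans h5, ?_⟩
          have h7 : swapMul hi σ d ≠ swapMul hi σ c := fun h => hcd' ((swapMul hi σ).injective h).symm
          have h8 : swapMul hi σ c = ⟨i, by omega⟩ := swapMul_left hi ha
          have h9 : swapMul hi σ b = ⟨i + 1, hi⟩ := swapMul_right hi hb
          rw [h8] at h7 ⊢
          rw [h9] at h6
          rw [Fin.lt_def] at h6 ⊢
          rw [Ne, Fin.ext_iff] at h7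
          dsimp only at h6 h7 ⊢
          omega
        have h6 : coordMatrix (swapMul hi σ) x b d = 0 := by
          simp only [coordMatrix, h5, dif_neg, not_false_eq_true, hbd, if_false]
        rw [h4, h6, if_neg hcd']
        simp
      · rw [h4, if_neg hcd']

theorem permRows_shear (hi : i + 1 < n) (ha : σ a = ⟨i + 1, hi⟩)
    (hb : σ b = ⟨i, by omega⟩) (hab : a < b) (t : ℝ) (x : Inversion (swapMul hi σ) → ℝ) :
    permRows σ (fun k => ((inversionEquiv hi ha hb hab).symm k).elim t
      (x + (t • rowShift (swapMul hi σ) a b) x)) =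
    shearSwap hi t (permRows (swapMul hi σ) x) := by
  have hperm : ∀ k, permRows (swapMul hi σ) x k = coordMatrix (swapMul hi σ) x
      (σ.symm (Equiv.swap (⟨i, by omega⟩ : Fin n) ⟨i + 1, hi⟩ k)) := by
    intro k
    have : (swapMul hi σ).symm k =
        σ.symm (Equiv.swap (⟨i, by omega⟩ : Fin n) ⟨i + 1, hi⟩ k) := by
      rw [Equiv.symm_apply_eq, swapMul, Equiv.Perm.mul_apply, Equiv.apply_symm_apply,
        Equiv.swap_apply_self]
    rw [← this]
    rfl
  have ha' : σ.symm ⟨i + 1, hi⟩ = a := by rw [← ha, Equiv.symm_apply_apply]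
  have hb' : σ.symm ⟨i, by omega⟩ = b := by rw [← hb, Equiv.symm_apply_apply]
  ext k l
  rw [permRows, submatrix_apply, coordMatrix_shear, id]
  simp only [shearSwap]
  by_cases hk : k.val = i
  · have : k = ⟨i, by omega⟩ := Fin.ext hk
    rw [this, hb', if_neg hab.ne', if_pos rfl, hperm, Equiv.swap_apply_right, hb']
  · by_cases hk' : k.val = i + 1
    · have : k = ⟨i + 1, hi⟩ := Fin.ext hk'
      rw [if_neg hk, if_pos hk', this, ha', if_pos rfl, Pi.add_apply, Pi.smul_apply, hperm, hperm, Equiv.swap_apply_left,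
        Equiv.swap_apply_right, ha', hb', smul_eq_mul]
    · rw [if_neg hk, if_neg hk', hperm, Equiv.swap_apply_of_ne_of_ne
        (fun h => hk (congrArg Fin.val h)) (fun h => hk' (congrArg Fin.val h)), if_neg]
      intro h
      rw [Equiv.symm_apply_eq, ha] at h
      exact hk' (congrArg Fin.val h)

theorem lintegral_weight_step (hi : i + 1 < n) (ha : σ a = ⟨i + 1, hi⟩)
    (hb : σ b = ⟨i, by omega⟩) (hab : a < b) (c : ℕ → ℝ) :
    ∫⁻ z, ENNReal.ofReal (weight c (permRows σ z)) =
      kernelIntegral (c i - c (i + 1)) *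
        ∫⁻ x, ENNReal.ofReal
          (weight (c ∘ Equiv.swap i (i + 1)) (permRows (swapMul hi σ) x)) := by
  have hcont : ∀ {α : Type} [TopologicalSpace α] (f : α → ℝ)
      (g : α → Inversion (swapMul hi σ) → ℝ), Continuous f → Continuous g →
      Continuous fun q => fun k => ((inversionEquiv hi ha hb hab).symm k).elim (f q) (g q) := by
    intro α _ f g hf hg
    refine continuous_pi fun k => ?_
    cases (inversionEquiv hi ha hb hab).symm k with
    | none => exact hf
    | some p => exact (continuous_apply p).comp hg
  have hN : ∀ t : ℝ, (t • rowShift (swapMul hi σ) a b) ∘ₗ (t • rowShift (swapMul hi σ) a b) = 0 := by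
    intro t
    rw [LinearMap.smul_comp, LinearMap.comp_smul, rowShift_comp_self _ hab.ne, smul_zero,
      smul_zero]
  have hNc : Continuous (rowShift (swapMul hi σ) a b) :=
    LinearMap.continuous_of_finiteDimensional _
  rw [lintegral_option (inversionEquiv hi ha hb hab) _
    (measurable_weight c (continuous_permRows σ))]
  have hshear : ∀ t : ℝ, ∫⁻ x, ENNReal.ofReal (weight c (permRows σ fun k =>
      ((inversionEquiv hi ha hb hab).symm k).elim t x)) =
      ∫⁻ x, ENNReal.ofReal (weight c (shearSwap hi t (permRows (swapMul hi σ) x))) := by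
    intro t
    rw [← lintegral_shear _ (hN t) (fun x => ENNReal.ofReal (weight c (permRows σ fun k =>
      ((inversionEquiv hi ha hb hab).symm k).elim t x))) (measurable_weight c
      ((continuous_permRows σ).comp (hcont (fun _ => t) id continuous_const continuous_id)))]
    exact lintegral_congr fun x => by rw [← permRows_shear hi ha hb hab]
  simp_rw [hshear]
  -- The shear depends on $t$, so it is undone for fixed $t$; Tonelli then makes $t$ the inner
  -- variable.
  rw [lintegral_lintegral_swap]
  · simp_rw [lintegral_weight_shearSwap hi c (det_permRows_ne_zero _ _)]
    rw [lintegral_const_mul _ (measurable_weight _ (continuous_permRows _))]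
  · refine Measurable.aemeasurable ?_
    simp_rw [Function.uncurry_def, ← permRows_shear hi ha hb hab]
    refine measurable_weight c ((continuous_permRows σ).comp (hcont _ _ continuous_fst ?_))
    exact continuous_snd.add (continuous_fst.smul (hNc.comp continuous_snd))

end Step

/-! ### Convergence by induction on the number of inversions -/

theorem exists_descent (σ : Equiv.Perm (Fin n)) [Nonempty (Inversion σ)] :
    ∃ (i : ℕ) (hi : i + 1 < n), σ.symm ⟨i + 1, hi⟩ < σ.symm ⟨i, by omega⟩ := by
  by_contra! hcon
  have hlt : ∀ (i : ℕ) (hi : i + 1 < n), σ.symm ⟨i, by omega⟩ < σ.symm ⟨i + 1, hi⟩ := fun i hi =>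
    lt_of_le_of_ne (hcon i hi) fun h => by simpa using σ.symm.injective h
  have hmono : ∀ (d i : ℕ) (hi : i + d + 1 < n),
      σ.symm ⟨i, by omega⟩ < σ.symm ⟨i + d + 1, hi⟩ := by
    intro d
    induction d with
    | zero => exact fun i hi => hlt i hi
    | succ d ih => exact fun i hi => (ih i (by omega)).trans (hlt (i + d + 1) hi)
  obtain ⟨⟨⟨c, d⟩, h1, h2⟩⟩ := ‹Nonempty (Inversion σ)›
  dsimp only at h1 h2
  have h3 := hmono ((σ c).val - (σ d).val - 1) (σ d).val (by omega)
  have h4 : (⟨(σ d).val + ((σ c).val - (σ d).val - 1) + 1, by omega⟩ : Fin n) = σ c :=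
    Fin.ext (by rw [Fin.lt_def] at h2; dsimp only; omega)
  rw [h4] at h3
  simp only [Fin.eta, Equiv.symm_apply_apply] at h3
  exact lt_asymm h1 h3

/-- The condition on `c` makes the kernel parameter positive at each descent. It is inherited
because `c ∘ s` at `s σ k` equals `c` at `σ k`, and the inversions of `s σ` are among those of `σ`.
-/
theorem lintegral_weight_ne_top (m : ℕ) : ∀ (σ : Equiv.Perm (Fin n)) (c : ℕ → ℝ),
    Fintype.card (Inversion σ) = m → (∀ a b, a < b → σ b < σ a → c (σ a).val < c (σ b).val) →
    ∫⁻ z, ENNReal.ofReal (weight c (permRows σ z)) ≠ ⊤ := by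
  induction m with
  | zero =>
    intro σ c hcard _
    have := Fintype.card_eq_zero_iff.1 hcard
    rw [Measure.volume_pi_eq_dirac, lintegral_dirac]
    exact ENNReal.ofReal_ne_top
  | succ m ih =>
    intro σ c hcard hc
    have : Nonempty (Inversion σ) := Fintype.card_pos_iff.1 (by omega)
    obtain ⟨i, hi, hab⟩ := exists_descent σ
    have ha := σ.apply_symm_apply ⟨i + 1, hi⟩
    have hb := σ.apply_symm_apply ⟨i, by omega⟩
    have hca := hc _ _ hab (by rw [ha, hb, Fin.lt_def]; exact Nat.lt_succ_self i)
    rw [ha, hb] at hca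
    rw [lintegral_weight_step hi ha hb hab]
    refine ENNReal.mul_ne_top (kernelIntegral_ne_top (sub_pos.2 hca)) (ih _ _ ?_ ?_)
    · have := Fintype.card_congr (inversionEquiv hi ha hb hab)
      rw [Fintype.card_option, hcard] at this
      omega
    · intro d e hde hlt
      have hval : ∀ k, (c ∘ Equiv.swap i (i + 1)) (swapMul hi σ k).val = c (σ k).val := by
        intro k
        rw [Function.comp_apply, swapMul, Equiv.Perm.mul_apply]
        congr 1
        by_cases h1 : σ k = ⟨i, by omega⟩
        · rw [h1, Equiv.swap_apply_left]
          exact Equiv.swap_apply_right i (i + 1)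
        · by_cases h2 : σ k = ⟨i + 1, hi⟩
          · rw [h2, Equiv.swap_apply_right]
            exact Equiv.swap_apply_left i (i + 1)
          · rw [Equiv.swap_apply_of_ne_of_ne h1 h2]
            exact Equiv.swap_apply_of_ne_of_ne (fun h => h1 (Fin.ext h)) fun h => h2 (Fin.ext h)
      rw [hval, hval]
      exact hc d e hde ((swapMul_inversion_iff hi ha hb hab (d, e)).1 ⟨hde, hlt⟩).1.2

/-! ### From convergence to the volume bound -/

theorem Delta_eq_sqrt_gramTail (j : ℕ) (g : GL (Fin n) ℝ) :
    Delta j g = √(gramTail (n - j) g.val) := by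
  let e : {k : Fin n // n - j ≤ k.val} ≃ {k : Fin n // n ≤ k.val + j} :=
    Equiv.subtypeEquivRight fun k => by omega
  rw [Delta, gramTail, ← det_submatrix_equiv_self e]
  rfl

theorem weight_ge_of_Delta_le {ε : ℝ} (hε : 0 < ε) (B : Fin (n - 1) → ℝ) (hB : ∀ j, 0 < B j)
    (g : GL (Fin n) ℝ) (hg : g.val.det ^ 2 = 1)
    (h : ∀ j : Fin (n - 1), Delta (j.val + 1) g ≤ B j) :
    ((∏ j, B j) ^ (1 + ε))⁻¹ ≤ weight (fun k => -ε * k) g.val := by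
  have hdet : g.val.det ≠ 0 := fun h0 => by simp [h0] at hg
  have hpos := fun j => gramTail_pos (n := n) j hdet
  have hprod : 0 < ∏ j, B j := Finset.prod_pos fun j _ => hB j
  have hlog : ∀ j : Fin (n - 1), Real.log (gramTail (n - (j.val + 1)) g.val) ≤
      2 * Real.log (B j) := by
    intro j
    have h1 := Real.log_le_log (by rw [Delta_eq_sqrt_gramTail]; exact Real.sqrt_pos.2 (hpos _)) (h j)
    rw [Delta_eq_sqrt_gramTail, Real.log_sqrt (hpos _).le] at h1
    linarith
  have hsum : ∑ k ∈ Finset.range n, Real.log (gramTail (k + 1) g.val) ≤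
      2 * Real.log (∏ j, B j) := by
    rw [Real.log_prod fun j _ => (hB j).ne', Finset.mul_sum]
    refine le_of_eq_of_le ?_ (Finset.sum_le_sum fun j _ => hlog j)
    rcases Nat.eq_zero_or_pos n with hn | hn
    · subst hn; simp
    · obtain ⟨m, rfl⟩ : ∃ m, n = m + 1 := ⟨n - 1, by omega⟩
      -- The empty Gram determinant $g_n=1$ drops out, and reversing the order matches
      -- $g_1,\dots,g_{n-1}$ with $\Delta_{n-1}^2,\dots,\Delta_1^2$.
      rw [Finset.sum_range_succ, gramTail_of_le le_rfl, Real.log_one, add_zero,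
        ← Finset.sum_range_reflect, Finset.sum_range]
      refine Finset.sum_congr rfl fun j _ => ?_
      congr 2
      have := j.2
      omega
  rw [weight, weightExponent_linear ε _ (by simp only [gramTail_zero, hg, Real.log_one])
    (by simp only [gramTail_of_le le_rfl, Real.log_one]), Real.rpow_def_of_pos hprod, ← Real.exp_neg]
  refine Real.exp_le_exp.2 ?_
  nlinarith

/-- Markov's inequality at the level $(\prod_j B_j)^{-(1+\epsilon)}$. -/
theorem weylMeasure_le {ε : ℝ} (hε : 0 < ε) (σ : Equiv.Perm (Fin n)) (B : Fin (n - 1) → ℝ)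
    (hB : ∀ j, 0 < B j) :
    weylMeasure σ {x : weylU σ | ∀ j : Fin (n - 1), Delta (j.val + 1) (weyl σ * x.val) ≤ B j} ≤
      ENNReal.ofReal ((∏ j, B j) ^ (1 + ε)) *
        ∫⁻ z, ENNReal.ofReal (weight (fun k => -ε * k) (permRows σ z)) := by
  set P := (∏ j, B j) ^ (1 + ε) with hP
  have hPpos : 0 < P := Real.rpow_pos_of_pos (Finset.prod_pos fun j _ => hB j) _
  have hmeas := (coord σ).symm.measurableEmbedding.map_apply (volume : Measure (Inversion σ → ℝ))
  rw [weylMeasure, hmeas]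
  have hm := mul_meas_ge_le_lintegral₀ (μ := (volume : Measure (Inversion σ → ℝ)))
    (measurable_weight (fun k => -ε * k) (continuous_permRows σ)).aemeasurable (ENNReal.ofReal P⁻¹)
  have hsub : (coord σ).symm ⁻¹' {x : weylU σ | ∀ j : Fin (n - 1),
      Delta (j.val + 1) (weyl σ * x.val) ≤ B j} ⊆
      {z | ENNReal.ofReal P⁻¹ ≤ ENNReal.ofReal (weight (fun k => -ε * k) (permRows σ z))} := by
    intro z hz
    have hd : (weyl σ * ((coord σ).symm z).val).val.det ^ 2 = 1 := by
      rw [permRows_eq, permRows, det_permute, det_coordMatrix, mul_one]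
      rcases Int.units_eq_one_or (Equiv.Perm.sign σ.symm) with h | h <;> simp [h]
    have := weight_ge_of_Delta_le hε B hB _ hd hz
    rw [permRows_eq] at this
    exact ENNReal.ofReal_le_ofReal this
  refine (measure_mono hsub).trans ?_
  calc _ = ENNReal.ofReal P * (ENNReal.ofReal P⁻¹ * volume {z | ENNReal.ofReal P⁻¹ ≤
        ENNReal.ofReal (weight (fun k => -ε * k) (permRows σ z))}) := by
        rw [← mul_assoc, ← ENNReal.ofReal_mul hPpos.le, mul_inv_cancel₀ hPpos.ne',
          ENNReal.ofReal_one, one_mul]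
    _ ≤ _ := by gcongr

end WeylVolume

/-- The coordinate `B j`, for `j : Fin (n - 1)`, is the number usually written `B_{j+1}`,
and it bounds `Δ_{j+1}`. -/
theorem mainTheorem4 (n : ℕ) (hn : 3 ≤ n) (ε : ℝ) (hε : 0 < ε) :
    ∃ C : ℝ, 0 < C ∧ ∀ (σ : Equiv.Perm (Fin n)) (B : Fin (n - 1) → ℝ), (∀ j, 0 < B j) →
      WeylVolume.weylMeasure σ {x : WeylVolume.weylU σ |
          ∀ j : Fin (n - 1), WeylVolume.Delta (j.val + 1) (WeylVolume.weyl σ * x.val) ≤ B j} ≤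
        ENNReal.ofReal (C * (∏ j, B j) ^ (1 + ε)) := by
  let J : Equiv.Perm (Fin n) → ENNReal := fun σ =>
    ∫⁻ z, ENNReal.ofReal (WeylVolume.weight (fun k => -ε * k) (WeylVolume.permRows σ z))
  have hJ : ∀ σ, J σ ≠ ⊤ := fun σ => by
    refine WeylVolume.lintegral_weight_ne_top _ σ _ rfl fun a b _ hba => ?_
    have : ((σ b).val : ℝ) < (σ a).val := by exact_mod_cast hba
    nlinarith
  -- Summing over all $\sigma$ makes the constant independent of $w$; the 1 secures positivity.
  refine ⟨1 + ∑ σ, (J σ).toReal, by positivity, fun σ B hB => ?_⟩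
  refine (WeylVolume.weylMeasure_le hε σ B hB).trans ?_
  have hP : 0 ≤ (∏ j, B j) ^ (1 + ε) :=
    Real.rpow_nonneg (Finset.prod_nonneg fun j _ => (hB j).le) _
  rw [mul_comm, mul_comm (1 + _), mul_comm, ENNReal.ofReal_mul hP]
  gcongr
  change J σ ≤ _
  rw [← ENNReal.ofReal_toReal (hJ σ)]
  refine ENNReal.ofReal_le_ofReal ?_
  have := Finset.single_le_sum (f := fun σ => (J σ).toReal) (fun _ _ => ENNReal.toReal_nonneg)
    (Finset.mem_univ σ)
  linarith
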